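/- Setting. All vectors are binary and $\oplus$ is addition mod 2. Let $p_1,\alpha\in[0,\tfrac12)$, $p=p_1(1-\alpha)+(1-p_1)\alpha$, and let $p<\tau<\tfrac12$. The ground truth $\mathbf A_0\in\{0,1\}^n$ is i.i.d. Bernoulli$(\tfrac12)$; the enrollment and probe vectors are $\mathbf A=\mathbf A_0\oplus\mathbf N_1$ and $\mathbf B=\mathbf A_0\oplus\mathbf N_2$, where $\mathbf N_1,\mathbf N_2$ are i.i.d. Bernoulli$(p_1)$ and Bernoulli$(\alpha)$ vectors, and $\mathbf A_0,\mathbf N_1,\mathbf N_2$ are independent. Fix a binary $[n,k]$ linear code with full-rank $k\times n$ generator matrix $\mathbf G$ and full-rank $m\times n$ parity check matrix $\mathbf H$, $\mathbf H\mathbf G^{\mathrm T}=0$, $m=n-k$, $R=k/n$. For a syndrome $\mathbf q$ let $\hat{\mathbf W}(\mathbf q)$ be a vector of least Hamming weight $d(\cdot)$ among those $\mathbf W$ with $\mathbf H\mathbf W=\mathbf q$ (ties broken by any fixed rule). Four systems $(\mathbf S,\mathbf K)=F(\mathbf A)$, $\hat\theta=g(\mathbf D,\mathbf L,\mathbf S)$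 are considered; in each, $g=1$ if $d(\hat{\mathbf W}(\mathbf q))\le\tau n$ and $g=0$ otherwise. Two-factor fuzzy commitment: $\mathbf S=\mathbf A\oplus\mathbf G^{\mathrm T}\mathbf Z\oplus\mathbf K$ with $\mathbf Z\in\{0,1\}^k$, $\mathbf K\in\{0,1\}^n$ uniform, $\mathbf q=\mathbf H(\mathbf D\oplus\mathbf L\oplus\mathbf S)$. Two-factor secure sketch: $\mathbf S=\mathbf H\mathbf A\oplus\mathbf K$ with $\mathbf K\in\{0,1\}^m$ uniform, $\mathbf q=\mathbf H\mathbf D\oplus\mathbf L\oplus\mathbf S$. Here $\mathbf K,\mathbf Z$ are independent of each other and of $(\mathbf A_0,\mathbf N_1,\mathbf N_2)$. The keyless variants are obtained by removing $\mathbf K$ and $\mathbf L$. Metrics. $P_{FR}=\Pr[g(\mathbf B,\mathbf K,\mathbf S)=0]$; $P_{FA}$ is the maximum of $\Pr[g(\mathbf C,\mathbf J,\mathbf S)=1]$ over all laws of $(\mathbf C,\mathbf J)$ independent of everything else; for $\mathcal V\subseteq\{\mathbf A,\mathbf S,\mathbf K\}$, $P_{SA}(\mathcal V)$ is the maximum of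 the same probability over all conditional laws of $(\mathbf C,\mathbf J)$ given $\mathcal V$ (in keyless systems $\mathbf K$ and $\mathbf J$ are absent). Further, $h_b(q)=-q\log_2q-(1-q)\log_2(1-q)$, $D(q\|p)=q\log_2\frac qp+(1-q)\log_2\frac{1-q}{1-p}$ (with the usual conventions; $+\infty$ if $p=0<q$), and $E(R)=\min_{0\le q\le1}\bigl(D(q\|p)+\max\{1-h_b(q)-R,0\}\bigr)$. Let $P_e$ be the probability that the decoder, applied to a uniform codeword sent over a binary symmetric channel with crossover probability $p$, does not return that codeword. Theorem. For every such code, the four systems have the same $P_{FR}$ and the same $P_{FA}$, and: (i) for codes with $P_e\le2^{-nE(R)+o(n)}$ as $n\to\infty$, $P_{FR}\le2^{-nD(\tau\|p)}+2^{-nE(R)+o(n)}$ (with the same $o(n)$ term); such codes exist for all $n$ and all $0\le k\le n$, with an $o(n)$ term that depends on $n$ and $p$ only, whatever the rule for ties; (ii) $P_{FA}\le2^{-n\left(\frac mn-h_b(\tau)\right)}$. For both two-factor systems: (iii) $P_{SA}(\mathbf K)=P_{FA}$; (iv) $P_{SA}(\mathbf A)=P_{FA}$; (v) $P_{SA}(\mathbf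 S)=P_{SA}(\mathbf A,\mathbf K)=P_{SA}(\mathbf A,\mathbf S)=P_{SA}(\mathbf S,\mathbf K)=P_{SA}(\mathbf A,\mathbf S,\mathbf K)=1$. For both keyless systems: (vi) $P_{SA}(\mathbf S)=P_{SA}(\mathbf A)=P_{SA}(\mathbf A,\mathbf S)=1$. -/

import Mathlib

open scoped ENNReal unitInterval

noncomputable section

namespace SecureBiometrics

/-! ### Binary vectors and their laws -/

/-- Binary vectors of length `n`; componentwise modulo-two addition is `+`. -/
abbrev Bits (n : ℕ) : Type := Fin n → ZMod 2

/-- The Bernoulli(`q`) law of one bit. -/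
def bernoulliBit (q : I) : PMF (ZMod 2) :=
  PMF.ofFintype (fun b => if b = 1 then ENNReal.ofReal q else ENNReal.ofReal (1 - q)) (by
    rw [show (Finset.univ : Finset (ZMod 2)) = {0, 1} from rfl, Finset.sum_pair (by decide),
      if_neg (by decide), if_pos rfl, ← ENNReal.ofReal_add (sub_nonneg.2 q.2.2) q.2.1]
    simp)

/-- The law of `n` i.i.d. Bernoulli(`q`) bits. -/
def bernoulliVec (q : I) (n : ℕ) : PMF (Bits n) :=
  PMF.ofFintype (fun x => ∏ i, bernoulliBit q (x i)) (by
    have h := Finset.prod_univ_sum (fun _ : Fin n => (Finset.univ : Finset (ZMod 2)))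
      (fun _ b => bernoulliBit q b)
    rw [Fintype.piFinset_univ] at h
    rw [← h]
    have h1 : ∑ b : ZMod 2, bernoulliBit q b = 1 := by
      rw [← tsum_fintype (L := SummationFilter.unconditional _)]
      exact (bernoulliBit q).tsum_coe
    simp [h1])

/-- The law of `n` i.i.d. Bernoulli(1/2) bits. -/
def fairVec (n : ℕ) : PMF (Bits n) :=
  bernoulliVec ⟨1 / 2, by norm_num, by norm_num⟩ n

/-- Crossover probability `p₁ * α = p₁ (1 - α) + (1 - p₁) α` of the concatenation of two binary
symmetric channels. -/
def bscComp (p₁ α : I) : I :=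
  ⟨p₁ * (1 - α) + (1 - p₁) * α, by
    have h1 := p₁.2.1; have h2 := p₁.2.2; have h3 := α.2.1; have h4 := α.2.2
    constructor
    · exact add_nonneg (mul_nonneg h1 (sub_nonneg.2 h4)) (mul_nonneg (sub_nonneg.2 h2) h3)
    · nlinarith [mul_nonneg h1 h3, mul_nonneg (sub_nonneg.2 h2) (sub_nonneg.2 h4)]⟩

/-! ### Secure biometric systems and their performance metrics -/

/-- A secure biometric system with feature vectors in `{0,1}ⁿ`, stored data in `S` and keys in `K`:
a randomized encoding `A ↦ (S, K)` and a decision function `(D, L, S) ↦ θ̂`. In a keyless system the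
key is null, `K = Unit`. -/
structure System (n : ℕ) (S K : Type) where
  enroll : Bits n → PMF (S × K)
  verify : Bits n → K → S → Bool

/-- The data that may be exposed: enrollment biometric, stored data, key. -/
inductive Datum
  | bio
  | stored
  | key

namespace System

variable {n : ℕ} {S K : Type}

/-- Joint law of `(A, B, S, K)`. The ground truth `A₀` is uniform, `A = A₀ + N₁` and `B = A₀ + N₂`
with independent noises of parameters `p₁` and `α`, and `(S, K)` is the encoding of `A`. -/
def law (sys : System n S K) (p₁ α : I) : PMF (Bits n × Bits n × S × K) :=
  (fairVec n).bind fun A₀ =>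
  (bernoulliVec p₁ n).bind fun N₁ =>
  (bernoulliVec α n).bind fun N₂ =>
  (sys.enroll (A₀ + N₁)).bind fun SK =>
  PMF.pure (A₀ + N₁, A₀ + N₂, SK.1, SK.2)

/-- False rejection rate: the probability that `g(B, K, S) = 0`. -/
def PFR (sys : System n S K) (p₁ α : I) : ℝ≥0∞ :=
  ((sys.law p₁ α).map fun (_, B, s, k) => sys.verify B k s) false

/-- False acceptance rate: the largest probability that `g(C, J, S) = 1`, over all laws of `(C, J)`,
where `(C, J)` is independent of all the other variables. -/
def PFA (sys : System n S K) (p₁ α : I) : ℝ≥0∞ :=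
  ⨆ adv : PMF (Bits n × K),
    ((sys.law p₁ α).bind fun (_, _, s, _) => adv.map fun (C, J) => sys.verify C J s) true

open Classical in
/-- What an adversary sees of `(A, S, K)` when exactly the data in `V` are exposed. -/
def view (V : Set Datum) (A : Bits n) (s : S) (k : K) : Option (Bits n) × Option S × Option K :=
  (if Datum.bio ∈ V then some A else none,
   if Datum.stored ∈ V then some s else none,
   if Datum.key ∈ V then some k else none)

/-- Successful attack rate: the largest probability that `g(C, J, S) = 1`, over all conditional laws
of `(C, J)` given the exposed data `V`. -/
def PSA (sys : System n S K) (p₁ α : I) (V : Set Datum) : ℝ≥0∞ :=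
  ⨆ adv : Option (Bits n) × Option S × Option K → PMF (Bits n × K),
    ((sys.law p₁ α).bind fun (A, _, s, k) =>
      (adv (view V A s k)).map fun (C, J) => sys.verify C J s) true

end System

/-! ### Linear codes -/

/-- A binary `[n, k]` linear code, given by a generator matrix `G` and a parity check matrix `H`, both
of full row rank, with `m = n - k` parity checks. -/
structure LinCode (n k m : ℕ) where
  G : Matrix (Fin k) (Fin n) (ZMod 2)
  H : Matrix (Fin m) (Fin n) (ZMod 2)
  dim : k + m = n
  G_rank : LinearIndependent (ZMod 2) G.row
  H_rank : LinearIndependent (ZMod 2) H.row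
  ortho : H * G.transpose = 0

namespace LinCode

variable {n k m : ℕ}

/-- `dec` is a syndrome decoder: `dec s` is a vector of least Hamming weight among the `W` with
`H W = s`. Ties are broken in an arbitrary way. -/
def IsDecoder (c : LinCode n k m) (dec : Bits m → Bits n) : Prop :=
  ∀ s, c.H.mulVec (dec s) = s ∧
    ∀ W, c.H.mulVec W = s → hammingNorm (dec s) ≤ hammingNorm W

/-- Probability of decoding error on the binary symmetric channel with crossover probability `p`: a
uniform codeword `X = Gᵀ Z` is sent, `Y = X + N` is received and decoded to `Y + dec (H Y)`. -/
def errorProb (c : LinCode n k m) (dec : Bits m → Bits n) (p : I) : ℝ≥0∞ :=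
  ((fairVec k).bind fun Z =>
    (bernoulliVec p n).map fun N =>
      let X := c.G.transpose.mulVec Z
      let Y := X + N
      decide (Y + dec (c.H.mulVec Y) ≠ X)) true

open Classical in
/-- The threshold test: access is granted iff the weight of the estimate `W` is at most `τ n`. -/
def threshold (τ : ℝ) (W : Bits n) : Bool :=
  decide ((hammingNorm W : ℝ) ≤ τ * n)

/-- Two-factor fuzzy commitment: `S = A + Gᵀ Z + K`. -/
def fuzzyKeyed (c : LinCode n k m) (dec : Bits m → Bits n) (τ : ℝ) : System n (Bits n) (Bits n) where
  enroll A := (fairVec n).bind fun K => (fairVec k).map fun Z =>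
    (A + c.G.transpose.mulVec Z + K, K)
  verify D L S := threshold τ (dec (c.H.mulVec (D + L + S)))

/-- Keyless fuzzy commitment: `S = A + Gᵀ Z`. -/
def fuzzyKeyless (c : LinCode n k m) (dec : Bits m → Bits n) (τ : ℝ) : System n (Bits n) Unit where
  enroll A := (fairVec k).map fun Z => (A + c.G.transpose.mulVec Z, ())
  verify D _ S := threshold τ (dec (c.H.mulVec (D + S)))

/-- Two-factor secure sketch: `S = H A + K`. -/
def sketchKeyed (c : LinCode n k m) (dec : Bits m → Bits n) (τ : ℝ) : System n (Bits m) (Bits m) where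
  enroll A := (fairVec m).map fun K => (c.H.mulVec A + K, K)
  verify D L S := threshold τ (dec (c.H.mulVec D + L + S))

/-- Keyless secure sketch: `S = H A`. -/
def sketchKeyless (c : LinCode n k m) (dec : Bits m → Bits n) (τ : ℝ) : System n (Bits m) Unit where
  enroll A := PMF.pure (c.H.mulVec A, ())
  verify D _ S := threshold τ (dec (c.H.mulVec D + S))

end LinCode

/-! ### Exponents, in bits -/

/-- The binary entropy function `h_b(q) = - q log₂ q - (1 - q) log₂ (1 - q)`. -/
def hb (q : ℝ) : ℝ := Real.binEntropy q / Real.log 2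

open Classical in
/-- The divergence `D(q‖p)` between Bernoulli(`q`) and Bernoulli(`p`) in bits; it is `+∞` when the
first law is not absolutely continuous with respect to the second. -/
def klBits (q p : ℝ) : EReal :=
  if (p = 0 ∧ q ≠ 0) ∨ (p = 1 ∧ q ≠ 1) then ⊤
  else ((q * Real.logb 2 (q / p) + (1 - q) * Real.logb 2 ((1 - q) / (1 - p)) : ℝ) : EReal)

/-- The error exponent `E(R) = min_q (D(q‖p) + max {1 - h_b(q) - R, 0})`. -/
def errorExponent (p R : ℝ) : EReal :=
  ⨅ q ∈ Set.Icc (0 : ℝ) 1, klBits q p + ((max (1 - hb q - R) 0 : ℝ) : EReal)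

/-- `2 ^ x` for an extended real exponent, with `2 ^ (-∞) = 0`. -/
def two_pow (x : EReal) : ℝ≥0∞ := EReal.exp (x * (Real.log 2 : ℝ))

end SecureBiometrics

end

open scoped ENNReal unitInterval

namespace SecureBiometrics

/-! ### Uniform and Bernoulli vectors -/

/-! Everything is read off the syndrome handed to the decoder. On a legitimate probe, enrollment
vector and key each occur twice and cancel modulo 2, and H annihilates the codeword. All four
systems therefore decode H N, with N the Bernoulli(p) noise between A and B (`law_eq`, `PFR_eq`).

An attack made without a certain uniform vector (A for false acceptance and for an exposed key, K
for an exposed biometric) meets a uniform syndrome, because H is onto and translations preserve the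
uniform law. No strategy then does better than another, and the rate is that of `blindDecision`.
With any other exposed data some attack reaches syndrome 0, which decodes to 0 and passes.

For the bounds, the decoded vector is never heavier than N, so a false rejection forces N to have
weight above τn, a Chernoff event. A least-weight decoder is injective, so accepted syndromes are at
most as many as the points of a Hamming ball, and each has probability 2⁻ᵐ.

Good codes come from random parity checks [1 | P]. A given nonzero word lies in such a code with
probability at most 2⁻ᵐ. The union bound over competitors no heavier than the noise, capped at 1 and
split by noise weight, yields at most n + 2 terms, each at most 2^(-nE(R)); log₂(n + 2) is the o(n)
term. -/

theorem fairVec_apply (n : ℕ) (x : Bits n) : fairVec n x = ((2 : ℝ≥0∞)⁻¹) ^ n := by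
  have h : ∀ b : ZMod 2, bernoulliBit ⟨1 / 2, by norm_num, by norm_num⟩ b = (2 : ℝ≥0∞)⁻¹ := by
    intro b
    have h2 : ENNReal.ofReal (1 / 2) = (2 : ℝ≥0∞)⁻¹ := by
      rw [one_div, ENNReal.ofReal_inv_of_pos two_pos]; norm_num
    simp only [bernoulliBit, PMF.ofFintype_apply]
    split_ifs
    · exact h2
    · rw [← h2]; norm_num
  simp only [fairVec, bernoulliVec, PMF.ofFintype_apply, h, Finset.prod_const, Finset.card_univ,
    Fintype.card_fin]

/-- The uniform law is invariant under translations. -/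
theorem fairVec_bind_add {β : Type*} (n : ℕ) (a : Bits n) (f : Bits n → PMF β) :
    ((fairVec n).bind fun x => f (x + a)) = (fairVec n).bind f := by
  ext y
  simp only [PMF.bind_apply, fairVec_apply]
  exact (Equiv.addRight a).tsum_eq (fun x => (2 : ℝ≥0∞)⁻¹ ^ n * f x y)

/-- A surjective linear map sends the uniform law to the uniform law. -/
theorem fairVec_map_linear {n m : ℕ} (φ : Bits n →ₗ[ZMod 2] Bits m)
    (hφ : Function.Surjective φ) : (fairVec n).map φ = fairVec m := by
  -- Translating by a preimage of y carries the fibre over 0 to the fibre over y, so the image law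
  -- is constant.
  have hinv : ∀ y, (fairVec n).map φ y = (fairVec n).map φ 0 := by
    intro y
    obtain ⟨x, rfl⟩ := hφ y
    have h : (fairVec n).map φ = (fairVec n).bind fun z => PMF.pure (φ (z + x)) :=
      (fairVec_bind_add n x fun z => PMF.pure (φ z)).symm
    calc (fairVec n).map φ (φ x)
        = ((fairVec n).bind fun z => PMF.pure (φ (z + x))) (φ x) := by rw [h]
      _ = (fairVec n).map φ 0 := by
          rw [PMF.map, PMF.bind_apply, PMF.bind_apply]
          simp [PMF.pure_apply, eq_comm]
  have hsum : ∑ y, (fairVec n).map φ y = 1 := by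
    rw [← tsum_fintype (L := SummationFilter.unconditional _)]
    exact PMF.tsum_coe _
  ext y
  rw [fairVec_apply, hinv y]
  simp only [hinv, Finset.sum_const, Finset.card_univ, nsmul_eq_mul] at hsum
  rw [← ENNReal.inv_pow]
  refine ENNReal.eq_inv_of_mul_eq_one_left ?_
  rw [mul_comm, ← hsum]
  simp

theorem bernoulliBit_zero (q : I) : bernoulliBit q 0 = ENNReal.ofReal (1 - q) := by
  simp [bernoulliBit, PMF.ofFintype_apply]

theorem bernoulliBit_one (q : I) : bernoulliBit q 1 = ENNReal.ofReal q := by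
  simp [bernoulliBit, PMF.ofFintype_apply]

theorem bernoulliVec_apply (q : I) (n : ℕ) (x : Bits n) :
    bernoulliVec q n x = ∏ i, bernoulliBit q (x i) := by
  simp [bernoulliVec, PMF.ofFintype_apply]

theorem bernoulliBit_conv (p₁ α : I) (x : ZMod 2) :
    ∑ b : ZMod 2, bernoulliBit p₁ b * bernoulliBit α (x - b) = bernoulliBit (bscComp p₁ α) x := by
  have h1 := p₁.2.1
  have h2 := sub_nonneg.2 p₁.2.2
  have h3 := α.2.1
  have h4 := sub_nonneg.2 α.2.2
  rw [show (Finset.univ : Finset (ZMod 2)) = {0, 1} from rfl, Finset.sum_pair (by decide)]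
  obtain rfl | rfl : x = 0 ∨ x = 1 := by revert x; decide
  · rw [show (0 : ZMod 2) - 0 = 0 from rfl, show (0 : ZMod 2) - 1 = 1 from rfl]
    simp only [bernoulliBit_zero, bernoulliBit_one, bscComp]
    rw [← ENNReal.ofReal_mul h2, ← ENNReal.ofReal_mul h1,
      ← ENNReal.ofReal_add (mul_nonneg h2 h4) (mul_nonneg h1 h3)]
    congr 1; ring
  · rw [show (1 : ZMod 2) - 0 = 1 from rfl, show (1 : ZMod 2) - 1 = 0 from rfl]
    simp only [bernoulliBit_zero, bernoulliBit_one, bscComp]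
    rw [← ENNReal.ofReal_mul h2, ← ENNReal.ofReal_mul h1,
      ← ENNReal.ofReal_add (mul_nonneg h2 h3) (mul_nonneg h1 h4)]
    congr 1; ring

/-- The sum of independent Bernoulli vectors is a Bernoulli vector. -/
theorem bernoulliVec_conv (p₁ α : I) (n : ℕ) :
    ((bernoulliVec p₁ n).bind fun N₁ => (bernoulliVec α n).map fun N₂ => N₁ + N₂) =
      bernoulliVec (bscComp p₁ α) n := by
  ext x
  have hmap : ∀ N₁ : Bits n, (bernoulliVec α n).map (fun N₂ => N₁ + N₂) x =
      ∏ i, bernoulliBit α (x i - N₁ i) := by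
    intro N₁
    rw [PMF.map_apply, tsum_eq_single (x - N₁)]
    · simp [bernoulliVec_apply]
    · intro y hy
      rw [if_neg]
      rintro rfl
      simp at hy
  rw [PMF.bind_apply, tsum_fintype]
  simp only [hmap, bernoulliVec_apply, ← Finset.prod_mul_distrib, ← bernoulliBit_conv]
  have h := Finset.prod_univ_sum (fun _ : Fin n => (Finset.univ : Finset (ZMod 2)))
    (fun i b => bernoulliBit p₁ b * bernoulliBit α (x i - b))
  rw [Fintype.piFinset_univ] at h
  exact h.symm

/-! ### Metrics of systems -/

namespace System

variable {n : ℕ} {S K : Type}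

/-- The enrollment vector is uniform and the probe is its output over a single binary symmetric
channel. -/
theorem law_eq (sys : System n S K) (p₁ α : I) :
    sys.law p₁ α = (fairVec n).bind fun A =>
      (bernoulliVec (bscComp p₁ α) n).bind fun N =>
      (sys.enroll A).bind fun SK => PMF.pure (A, A + N, SK.1, SK.2) := by
  -- In characteristic 2 the probe A₀ + N₂ is A + (N₁ + N₂).
  have hchar : ∀ a b c : Bits n, a + c = a + b + (b + c) := by
    intro a b c
    rw [show a + b + (b + c) = a + (b + b) + c by abel, ZModModule.add_self, add_zero]
  set F : Bits n → Bits n → PMF (Bits n × Bits n × S × K) := fun A N =>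
    (sys.enroll A).bind fun SK => PMF.pure (A, A + N, SK.1, SK.2) with hF
  have h1 : sys.law p₁ α = (fairVec n).bind fun A₀ => (bernoulliVec p₁ n).bind fun N₁ =>
      (bernoulliVec α n).bind fun N₂ => F (A₀ + N₁) (N₁ + N₂) := by
    simp only [law, hF, ← hchar]
  rw [h1, PMF.bind_comm, ← bernoulliVec_conv]
  rw [PMF.bind_comm (fairVec n)]
  simp only [PMF.bind_bind, PMF.bind_map, Function.comp_def]
  congr 1
  funext N₁
  -- For fixed N₁ the shifted vector A₀ + N₁ is again uniform, hence A is independent of N₁ + N₂.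
  rw [fairVec_bind_add n N₁ fun A => (bernoulliVec α n).bind fun N₂ => F A (N₁ + N₂),
    PMF.bind_comm]

theorem view_key (A : Bits n) (s : S) (k : K) :
    view {Datum.key} A s k = (none, none, some k) := by
  simp [view]

theorem view_bio (A : Bits n) (s : S) (k : K) :
    view {Datum.bio} A s k = (some A, none, none) := by
  simp [view]

/-- Identities between the stored data and the key hold only for pairs that enrollment can produce.
-/
theorem bind_congr_support {β γ : Type*} (μ : PMF β) {f g : β → PMF γ}
    (h : ∀ x ∈ μ.support, f x = g x) : μ.bind f = μ.bind g := by
  ext y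
  simp only [PMF.bind_apply]
  refine tsum_congr fun x => ?_
  by_cases hx : x ∈ μ.support
  · rw [h x hx]
  · rw [(PMF.apply_eq_zero_iff μ x).2 hx, zero_mul, zero_mul]

/-- If the decision on a legitimate probe is a function of the noise, so is the rejection rate. -/
theorem PFR_eq (sys : System n S K) (p₁ α : I) (f : Bits n → Bool)
    (h : ∀ A N, ∀ SK ∈ (sys.enroll A).support, sys.verify (A + N) SK.2 SK.1 = f N) :
    sys.PFR p₁ α = (bernoulliVec (bscComp p₁ α) n).map f false := by
  have : ((sys.law p₁ α).map fun (_, B, s, k) => sys.verify B k s) =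
      (bernoulliVec (bscComp p₁ α) n).map f := by
    rw [law_eq, PMF.map]
    simp only [PMF.bind_bind, PMF.pure_bind, Function.comp_def]
    have : ∀ A N, ((sys.enroll A).bind fun SK => PMF.pure (sys.verify (A + N) SK.2 SK.1)) =
        PMF.pure (f N) := by
      intro A N
      rw [bind_congr_support _ (g := fun _ => PMF.pure (f N)) fun SK hSK => by rw [h A N SK hSK],
        PMF.bind_const]
    simp only [this, PMF.bind_const]
    rfl
  rw [PFR, this]

/-- Averages over the law of functions that do not involve the probe. -/
theorem law_bind {β : Type*} (sys : System n S K) (p₁ α : I) (f : Bits n → S → K → PMF β) :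
    ((sys.law p₁ α).bind fun (A, _, s, k) => f A s k) =
      (fairVec n).bind fun A => (sys.enroll A).bind fun SK => f A SK.1 SK.2 := by
  rw [law_eq]
  simp only [PMF.bind_bind, PMF.pure_bind, PMF.bind_const]

/-- An attack drawn independently of x may be drawn first and held fixed. -/
theorem bind_map_eq_of_forall {β γ δ : Type*} (μ : PMF β) (ν : PMF γ) (f : γ → β → δ) (ρ : PMF δ)
    (h : ∀ c, μ.map (f c) = ρ) : (μ.bind fun x => ν.map fun c => f c x) = ρ := by
  simp only [PMF.map, Function.comp_def] at h ⊢
  rw [PMF.bind_comm]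
  simp only [h, PMF.bind_const]

/-- If the decision on any fixed attack has the same law, that law gives the false acceptance
rate. -/
theorem PFA_eq (sys : System n S K) (p₁ α : I) (ρ : PMF Bool) (C₀ : Bits n) (J₀ : K)
    (h : ∀ C J, ((fairVec n).bind fun A => (sys.enroll A).map fun SK => sys.verify C J SK.1) = ρ) :
    sys.PFA p₁ α = ρ true := by
  have : ∀ adv : PMF (Bits n × K), ((sys.law p₁ α).bind fun (_, _, s, _) =>
      adv.map fun (C, J) => sys.verify C J s) = ρ := by
    intro adv
    refine (law_bind sys p₁ α (fun _ s _ => adv.map fun CJ => sys.verify CJ.1 CJ.2 s)).trans ?_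
    have := bind_map_eq_of_forall ((fairVec n).bind fun A => sys.enroll A) adv
      (fun CJ SK => sys.verify CJ.1 CJ.2 SK.1) ρ fun CJ => by
        rw [PMF.map_bind]; exact h CJ.1 CJ.2
    rw [PMF.bind_bind] at this
    exact this
  rw [PFA]
  simp only [this]
  have : Nonempty (PMF (Bits n × K)) := ⟨PMF.pure (C₀, J₀)⟩
  exact ciSup_const

/-- If all strategies lead to one decision law, the supremum runs over a constant family; `C₀` and
`J₀` only show that this family is nonempty. -/
theorem PSA_eq (sys : System n S K) (p₁ α : I) (V : Set Datum) (ρ : PMF Bool) (C₀ : Bits n) (J₀ : K)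
    (h : ∀ adv : Option (Bits n) × Option S × Option K → PMF (Bits n × K),
      ((fairVec n).bind fun A => (sys.enroll A).bind fun SK =>
        (adv (view V A SK.1 SK.2)).map fun CJ => sys.verify CJ.1 CJ.2 SK.1) = ρ) :
    sys.PSA p₁ α V = ρ true := by
  have : ∀ adv : Option (Bits n) × Option S × Option K → PMF (Bits n × K),
      ((sys.law p₁ α).bind fun (A, _, s, k) =>
        (adv (view V A s k)).map fun (C, J) => sys.verify C J s) = ρ := by
    intro adv
    have hlaw := law_bind sys p₁ α
      (fun A s k => (adv (view V A s k)).map fun CJ => sys.verify CJ.1 CJ.2 s)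
    rw [h adv] at hlaw
    exact hlaw
  rw [PSA]
  simp only [this]
  have : Nonempty (Option (Bits n) × Option S × Option K → PMF (Bits n × K)) :=
    ⟨fun _ => PMF.pure (C₀, J₀)⟩
  exact ciSup_const

/-- An attack that is always accepted gives successful attack rate one. -/
theorem PSA_eq_one (sys : System n S K) (p₁ α : I) (V : Set Datum)
    (φ : Option (Bits n) × Option S × Option K → Bits n × K)
    (h : ∀ A, ∀ SK ∈ (sys.enroll A).support,
      sys.verify (φ (view V A SK.1 SK.2)).1 (φ (view V A SK.1 SK.2)).2 SK.1 = true) :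
    sys.PSA p₁ α V = 1 := by
  refine le_antisymm (iSup_le fun adv => PMF.coe_le_one _ _) ?_
  refine le_iSup_of_le (fun v => PMF.pure (φ v)) ?_
  have hlaw := law_bind sys p₁ α (fun A s k => (PMF.pure (φ (view V A s k))).map
    fun CJ => sys.verify CJ.1 CJ.2 s)
  have : ∀ A, ((sys.enroll A).bind fun SK => (PMF.pure (φ (view V A SK.1 SK.2))).map
      fun CJ => sys.verify CJ.1 CJ.2 SK.1) = PMF.pure true := by
    intro A
    rw [bind_congr_support _ (g := fun _ => PMF.pure true) fun SK hSK => by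
      rw [PMF.pure_map, h A SK hSK], PMF.bind_const]
  have h2 : ((fairVec n).bind fun A => (sys.enroll A).bind fun SK =>
      (PMF.pure (φ (view V A SK.1 SK.2))).map fun CJ => sys.verify CJ.1 CJ.2 SK.1) =
      PMF.pure true := by
    simp only [this, PMF.bind_const]
  exact le_of_eq (by rw [← PMF.pure_apply_self true]; exact (DFunLike.congr_fun (hlaw.trans h2) true).symm)

end System

namespace LinCode

/-! ### The four systems -/

variable {n k m : ℕ} (c : LinCode n k m)

theorem H_G_mulVec (z : Bits k) : c.H.mulVec (c.G.transpose.mulVec z) = 0 := by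
  rw [Matrix.mulVec_mulVec, c.ortho, Matrix.zero_mulVec]

theorem H_surjective : Function.Surjective c.H.mulVec := by
  have h : Function.Surjective c.H.mulVecLin := by
    rw [← LinearMap.range_eq_top]
    apply Submodule.eq_top_of_finrank_eq
    have := c.H_rank.rank_matrix
    rw [Matrix.rank] at this
    rw [this]
    simp
  exact h

/-- The one-time pad of all blind attacks: H A is uniform since H is onto, and a fixed shift keeps
it uniform. -/
theorem fairVec_bind_H {β : Type*} (x : Bits m) (f : Bits m → PMF β) :
    ((fairVec n).bind fun A => f (c.H.mulVec A + x)) = (fairVec m).bind f := by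
  have h : (fairVec n).map c.H.mulVecLin = fairVec m := fairVec_map_linear _ c.H_surjective
  rw [← fairVec_bind_add m x, ← h, PMF.bind_map]
  rfl

theorem dec_zero {dec : Bits m → Bits n} (hdec : c.IsDecoder dec) : dec 0 = 0 := by
  have := (hdec 0).2 0 (Matrix.mulVec_zero _)
  simpa using this

theorem threshold_dec_zero {dec : Bits m → Bits n} (hdec : c.IsDecoder dec) {τ : ℝ} (hτ : 0 ≤ τ) :
    threshold τ (dec 0) = true := by
  rw [c.dec_zero hdec]
  simp only [threshold, hammingNorm_zero, Nat.cast_zero, decide_eq_true_eq]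
  positivity

theorem add_add_cancel_mid {l : ℕ} (a b d : Bits l) : a + b + (d + b) = a + d := by
  rw [show a + b + (d + b) = a + d + (b + b) by abel, ZModModule.add_self, add_zero]

/-! ### False rejection: the syndrome of the noise -/

section PFR

variable (dec : Bits m → Bits n) (τ : ℝ) (p₁ α : I)

theorem fuzzyKeyed_PFR : (c.fuzzyKeyed dec τ).PFR p₁ α =
    (bernoulliVec (bscComp p₁ α) n).map (fun N => threshold τ (dec (c.H.mulVec N))) false := by
  refine System.PFR_eq _ _ _ _ fun A N SK hSK => ?_
  simp only [fuzzyKeyed, PMF.mem_support_bind_iff, PMF.mem_support_map_iff] at hSK ⊢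
  obtain ⟨K, -, Z, -, rfl⟩ := hSK
  simp only
  rw [show A + N + K + (A + c.G.transpose.mulVec Z + K) =
    N + c.G.transpose.mulVec Z + (A + A) + (K + K) by abel, ZModModule.add_self,
    ZModModule.add_self, add_zero, add_zero, Matrix.mulVec_add, c.H_G_mulVec, add_zero]

theorem fuzzyKeyless_PFR : (c.fuzzyKeyless dec τ).PFR p₁ α =
    (bernoulliVec (bscComp p₁ α) n).map (fun N => threshold τ (dec (c.H.mulVec N))) false := by
  refine System.PFR_eq _ _ _ _ fun A N SK hSK => ?_
  simp only [fuzzyKeyless, PMF.mem_support_map_iff] at hSK ⊢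
  obtain ⟨Z, -, rfl⟩ := hSK
  simp only
  rw [show A + N + (A + c.G.transpose.mulVec Z) =
    N + c.G.transpose.mulVec Z + (A + A) by abel, ZModModule.add_self,
    add_zero, Matrix.mulVec_add, c.H_G_mulVec, add_zero]

theorem sketchKeyed_PFR : (c.sketchKeyed dec τ).PFR p₁ α =
    (bernoulliVec (bscComp p₁ α) n).map (fun N => threshold τ (dec (c.H.mulVec N))) false := by
  refine System.PFR_eq _ _ _ _ fun A N SK hSK => ?_
  simp only [sketchKeyed, PMF.mem_support_map_iff] at hSK ⊢
  obtain ⟨K, -, rfl⟩ := hSK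
  simp only
  rw [Matrix.mulVec_add, show c.H.mulVec A + c.H.mulVec N + K + (c.H.mulVec A + K) =
    c.H.mulVec N + (c.H.mulVec A + c.H.mulVec A) + (K + K) by abel, ZModModule.add_self,
    ZModModule.add_self, add_zero, add_zero]

theorem sketchKeyless_PFR : (c.sketchKeyless dec τ).PFR p₁ α =
    (bernoulliVec (bscComp p₁ α) n).map (fun N => threshold τ (dec (c.H.mulVec N))) false := by
  refine System.PFR_eq _ _ _ _ fun A N SK hSK => ?_
  simp only [sketchKeyless, PMF.mem_support_pure_iff] at hSK ⊢
  subst hSK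
  simp only
  rw [Matrix.mulVec_add, show c.H.mulVec A + c.H.mulVec N + c.H.mulVec A =
    c.H.mulVec N + (c.H.mulVec A + c.H.mulVec A) by abel, ZModModule.add_self, add_zero]

end PFR

/-! ### Blind and successful attacks -/

section Attack

variable (dec : Bits m → Bits n) (τ : ℝ) (p₁ α : I)

/-- The law of the decision when the syndrome is uniform. -/
noncomputable def blindDecision : PMF Bool := (fairVec m).map fun q => threshold τ (dec q)

theorem fuzzyKeyed_PFA : (c.fuzzyKeyed dec τ).PFA p₁ α = blindDecision dec τ true := by
  refine System.PFA_eq _ _ _ _ 0 0 fun C J => ?_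
  simp only [fuzzyKeyed, PMF.map_bind, PMF.map_comp, Function.comp_def]
  rw [PMF.bind_comm]
  have : ∀ K : Bits n, ((fairVec n).bind fun A => (fairVec k).map fun Z =>
      threshold τ (dec (c.H.mulVec (C + J + (A + c.G.transpose.mulVec Z + K))))) =
      blindDecision dec τ := by
    intro K
    have h : ∀ A : Bits n, ∀ Z : Bits k, c.H.mulVec (C + J + (A + c.G.transpose.mulVec Z + K)) =
        c.H.mulVec A + c.H.mulVec (C + J + K) := by
      intro A Z
      simp only [Matrix.mulVec_add, c.H_G_mulVec]
      abel
    simp only [h, PMF.map, Function.comp_def, PMF.bind_const]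
    exact c.fairVec_bind_H _ fun q => PMF.pure (threshold τ (dec q))
  simp only [this, PMF.bind_const]

theorem fuzzyKeyless_PFA : (c.fuzzyKeyless dec τ).PFA p₁ α = blindDecision dec τ true := by
  refine System.PFA_eq _ _ _ _ 0 () fun C J => ?_
  simp only [fuzzyKeyless, PMF.map_comp, Function.comp_def]
  have h : ∀ A : Bits n, ∀ Z : Bits k, c.H.mulVec (C + (A + c.G.transpose.mulVec Z)) =
      c.H.mulVec A + c.H.mulVec C := by
    intro A Z
    simp only [Matrix.mulVec_add, c.H_G_mulVec]
    abel
  simp only [h, PMF.map, Function.comp_def, PMF.bind_const]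
  exact c.fairVec_bind_H _ fun q => PMF.pure (threshold τ (dec q))

theorem sketchKeyed_PFA : (c.sketchKeyed dec τ).PFA p₁ α = blindDecision dec τ true := by
  refine System.PFA_eq _ _ _ _ 0 0 fun C J => ?_
  simp only [sketchKeyed, Function.comp_def, PMF.map, PMF.bind_bind, PMF.pure_bind]
  rw [PMF.bind_comm]
  have : ∀ K : Bits m, ((fairVec n).bind fun A =>
      PMF.pure (threshold τ (dec (c.H.mulVec C + J + (c.H.mulVec A + K))))) =
      blindDecision dec τ := by
    intro K
    have h : ∀ A : Bits n, c.H.mulVec C + J + (c.H.mulVec A + K) =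
        c.H.mulVec A + (c.H.mulVec C + J + K) := by
      intro A; abel
    simp only [h]
    exact c.fairVec_bind_H _ fun q => PMF.pure (threshold τ (dec q))
  simp only [this, PMF.bind_const]

theorem sketchKeyless_PFA : (c.sketchKeyless dec τ).PFA p₁ α = blindDecision dec τ true := by
  refine System.PFA_eq _ _ _ _ 0 () fun C J => ?_
  simp only [sketchKeyless, PMF.pure_map, add_comm (c.H.mulVec C)]
  exact c.fairVec_bind_H _ fun q => PMF.pure (threshold τ (dec q))

/-- Once K and Z are fixed, the attack no longer depends on A, and H A still masks the syndrome. -/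
theorem fuzzyKeyed_PSA_key :
    (c.fuzzyKeyed dec τ).PSA p₁ α {Datum.key} = blindDecision dec τ true := by
  refine System.PSA_eq _ _ _ _ _ 0 0 fun adv => ?_
  simp only [fuzzyKeyed, PMF.bind_bind, PMF.bind_map, Function.comp_def, System.view_key]
  rw [PMF.bind_comm, ← PMF.bind_const (fairVec n) (blindDecision dec τ)]
  congr 1
  funext K
  rw [PMF.bind_comm, ← PMF.bind_const (fairVec k) (blindDecision dec τ)]
  congr 1
  funext Z
  refine System.bind_map_eq_of_forall _ _ _ _ fun CJ => ?_
  have h : ∀ A : Bits n, c.H.mulVec (CJ.1 + CJ.2 + (A + c.G.transpose.mulVec Z + K)) =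
      c.H.mulVec A + c.H.mulVec (CJ.1 + CJ.2 + K) := by
    intro A
    simp only [Matrix.mulVec_add, c.H_G_mulVec]
    abel
  simp only [h]
  exact c.fairVec_bind_H _ fun q => PMF.pure (threshold τ (dec q))

theorem sketchKeyed_PSA_key :
    (c.sketchKeyed dec τ).PSA p₁ α {Datum.key} = blindDecision dec τ true := by
  refine System.PSA_eq _ _ _ _ _ 0 0 fun adv => ?_
  simp only [sketchKeyed, PMF.bind_map, Function.comp_def, System.view_key]
  rw [PMF.bind_comm, ← PMF.bind_const (fairVec m) (blindDecision dec τ)]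
  congr 1
  funext K
  refine System.bind_map_eq_of_forall _ _ _ _ fun CJ => ?_
  have h : ∀ A : Bits n, c.H.mulVec CJ.1 + CJ.2 + (c.H.mulVec A + K) =
      c.H.mulVec A + (c.H.mulVec CJ.1 + CJ.2 + K) := fun A => by abel
  simp only [h]
  exact c.fairVec_bind_H _ fun q => PMF.pure (threshold τ (dec q))

/-- The roles are exchanged: with A and Z fixed, the unseen key K is the mask. -/
theorem fuzzyKeyed_PSA_bio :
    (c.fuzzyKeyed dec τ).PSA p₁ α {Datum.bio} = blindDecision dec τ true := by
  refine System.PSA_eq _ _ _ _ _ 0 0 fun adv => ?_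
  simp only [fuzzyKeyed, PMF.bind_bind, PMF.bind_map, Function.comp_def, System.view_bio]
  rw [← PMF.bind_const (fairVec n) (blindDecision dec τ)]
  congr 1
  funext A
  rw [PMF.bind_comm, ← PMF.bind_const (fairVec k) (blindDecision dec τ)]
  congr 1
  funext Z
  refine System.bind_map_eq_of_forall _ _ _ _ fun CJ => ?_
  have h : ∀ K : Bits n, c.H.mulVec (CJ.1 + CJ.2 + (A + c.G.transpose.mulVec Z + K)) =
      c.H.mulVec K + c.H.mulVec (CJ.1 + CJ.2 + A) := by
    intro K
    simp only [Matrix.mulVec_add, c.H_G_mulVec]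
    abel
  simp only [h]
  exact c.fairVec_bind_H _ fun q => PMF.pure (threshold τ (dec q))

theorem sketchKeyed_PSA_bio :
    (c.sketchKeyed dec τ).PSA p₁ α {Datum.bio} = blindDecision dec τ true := by
  refine System.PSA_eq _ _ _ _ _ 0 0 fun adv => ?_
  simp only [sketchKeyed, PMF.bind_map, Function.comp_def, System.view_bio]
  rw [← PMF.bind_const (fairVec n) (blindDecision dec τ)]
  congr 1
  funext A
  refine System.bind_map_eq_of_forall _ _ _ _ fun CJ => ?_
  have h : ∀ K : Bits m, c.H.mulVec CJ.1 + CJ.2 + (c.H.mulVec A + K) =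
      K + (c.H.mulVec CJ.1 + CJ.2 + c.H.mulVec A) := fun K => by abel
  simp only [h]
  exact fairVec_bind_add m _ fun q => PMF.pure (threshold τ (dec q))

variable {dec τ}

theorem fuzzyKeyed_PSA_stored (hdec : c.IsDecoder dec) (hτ : 0 ≤ τ) (V : Set Datum)
    (hV : Datum.stored ∈ V) : (c.fuzzyKeyed dec τ).PSA p₁ α V = 1 := by
  -- Submitting the stored vector as biometric, with zero key, cancels it in the syndrome.
  refine System.PSA_eq_one _ _ _ _ (fun v => (v.2.1.getD 0, 0)) fun A SK _ => ?_
  simp only [fuzzyKeyed, System.view, if_pos hV, Option.getD_some, add_zero, ZModModule.add_self,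
    Matrix.mulVec_zero]
  exact c.threshold_dec_zero hdec hτ

theorem fuzzyKeyed_PSA_bio_key (hdec : c.IsDecoder dec) (hτ : 0 ≤ τ) (V : Set Datum)
    (hV : Datum.bio ∈ V) (hV' : Datum.key ∈ V) : (c.fuzzyKeyed dec τ).PSA p₁ α V = 1 := by
  refine System.PSA_eq_one _ _ _ _ (fun v => (v.1.getD 0, v.2.2.getD 0)) fun A SK hSK => ?_
  simp only [fuzzyKeyed, PMF.mem_support_bind_iff, PMF.mem_support_map_iff] at hSK
  obtain ⟨K, -, Z, -, rfl⟩ := hSK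
  simp only [fuzzyKeyed, System.view, if_pos hV, if_pos hV', Option.getD_some]
  rw [add_add_cancel_mid, ← add_assoc, ZModModule.add_self, zero_add, c.H_G_mulVec]
  exact c.threshold_dec_zero hdec hτ

theorem sketchKeyed_PSA_stored (hdec : c.IsDecoder dec) (hτ : 0 ≤ τ) (V : Set Datum)
    (hV : Datum.stored ∈ V) : (c.sketchKeyed dec τ).PSA p₁ α V = 1 := by
  refine System.PSA_eq_one _ _ _ _ (fun v => (0, v.2.1.getD 0)) fun A SK _ => ?_
  simp only [sketchKeyed, System.view, if_pos hV, Option.getD_some, zero_add, ZModModule.add_self,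
    Matrix.mulVec_zero]
  exact c.threshold_dec_zero hdec hτ

theorem sketchKeyed_PSA_bio_key (hdec : c.IsDecoder dec) (hτ : 0 ≤ τ) (V : Set Datum)
    (hV : Datum.bio ∈ V) (hV' : Datum.key ∈ V) : (c.sketchKeyed dec τ).PSA p₁ α V = 1 := by
  refine System.PSA_eq_one _ _ _ _ (fun v => (v.1.getD 0, v.2.2.getD 0)) fun A SK hSK => ?_
  simp only [sketchKeyed, PMF.mem_support_map_iff] at hSK
  obtain ⟨K, -, rfl⟩ := hSK
  simp only [sketchKeyed, System.view, if_pos hV, if_pos hV', Option.getD_some, ZModModule.add_self]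
  exact c.threshold_dec_zero hdec hτ

theorem fuzzyKeyless_PSA_stored (hdec : c.IsDecoder dec) (hτ : 0 ≤ τ) (V : Set Datum)
    (hV : Datum.stored ∈ V) : (c.fuzzyKeyless dec τ).PSA p₁ α V = 1 := by
  refine System.PSA_eq_one _ _ _ _ (fun v => (v.2.1.getD 0, ())) fun A SK _ => ?_
  simp only [fuzzyKeyless, System.view, if_pos hV, Option.getD_some, ZModModule.add_self,
    Matrix.mulVec_zero]
  exact c.threshold_dec_zero hdec hτ

theorem fuzzyKeyless_PSA_bio (hdec : c.IsDecoder dec) (hτ : 0 ≤ τ) (V : Set Datum)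
    (hV : Datum.bio ∈ V) : (c.fuzzyKeyless dec τ).PSA p₁ α V = 1 := by
  refine System.PSA_eq_one _ _ _ _ (fun v => (v.1.getD 0, ())) fun A SK hSK => ?_
  simp only [fuzzyKeyless, PMF.mem_support_map_iff] at hSK
  obtain ⟨Z, -, rfl⟩ := hSK
  simp only [fuzzyKeyless, System.view, if_pos hV, Option.getD_some]
  rw [← add_assoc, ZModModule.add_self, zero_add, c.H_G_mulVec]
  exact c.threshold_dec_zero hdec hτ

theorem sketchKeyless_PSA_stored (hdec : c.IsDecoder dec) (hτ : 0 ≤ τ) (V : Set Datum)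
    (hV : Datum.stored ∈ V) : (c.sketchKeyless dec τ).PSA p₁ α V = 1 := by
  -- The stored datum is itself a syndrome; decoding it gives a vector that has this syndrome.
  refine System.PSA_eq_one _ _ _ _ (fun v => (dec (v.2.1.getD 0), ())) fun A SK _ => ?_
  simp only [sketchKeyless, System.view, if_pos hV, Option.getD_some, (hdec _).1,
    ZModModule.add_self]
  exact c.threshold_dec_zero hdec hτ

theorem sketchKeyless_PSA_bio (hdec : c.IsDecoder dec) (hτ : 0 ≤ τ) (V : Set Datum)
    (hV : Datum.bio ∈ V) : (c.sketchKeyless dec τ).PSA p₁ α V = 1 := by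
  refine System.PSA_eq_one _ _ _ _ (fun v => (v.1.getD 0, ())) fun A SK hSK => ?_
  simp only [sketchKeyless, PMF.mem_support_pure_iff] at hSK
  subst hSK
  simp only [sketchKeyless, System.view, if_pos hV, Option.getD_some, ZModModule.add_self]
  exact c.threshold_dec_zero hdec hτ

end Attack

end LinCode

/-! ### Exponential bounds -/

theorem two_pow_coe (x : ℝ) : two_pow (x : EReal) = ENNReal.ofReal (Real.exp (x * Real.log 2)) := by
  rw [two_pow, ← EReal.coe_mul, EReal.exp_coe]

theorem two_pow_mono : Monotone two_pow := by
  intro x y h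
  refine EReal.exp_monotone ?_
  have : (0 : EReal) ≤ (Real.log 2 : ℝ) := by exact_mod_cast Real.log_nonneg one_le_two
  gcongr

theorem two_pow_bot : two_pow ⊥ = 0 := by
  rw [two_pow, EReal.bot_mul_coe_of_pos (Real.log_pos one_lt_two), EReal.exp_bot]

theorem two_pow_add_coe (x : EReal) (y : ℝ) : two_pow (x + y) = two_pow x * two_pow y := by
  have hl := Real.log_pos one_lt_two
  induction x with
  | bot => rw [EReal.bot_add, two_pow_bot, zero_mul]
  | coe x =>
    rw [← EReal.coe_add, two_pow_coe, two_pow_coe, two_pow_coe,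
      ← ENNReal.ofReal_mul (Real.exp_pos _).le, ← Real.exp_add, add_mul]
  | top =>
    rw [EReal.top_add_coe, two_pow, EReal.top_mul_coe_of_pos hl, EReal.exp_top, two_pow_coe,
      ENNReal.top_mul]
    simpa using Real.exp_pos _

theorem inv_two_pow_eq (m : ℕ) : ((2 : ℝ≥0∞)⁻¹) ^ m = two_pow ((-m : ℝ) : EReal) := by
  rw [two_pow_coe, neg_mul, Real.exp_neg, ENNReal.ofReal_inv_of_pos (Real.exp_pos _),
    Real.exp_nat_mul, Real.exp_log two_pos, ENNReal.ofReal_pow zero_le_two, ENNReal.inv_pow]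
  norm_num

theorem bernoulliVec_eq_ofReal (q : I) (n : ℕ) (x : Bits n) :
    bernoulliVec q n x =
      ENNReal.ofReal ((q : ℝ) ^ hammingNorm x * (1 - q) ^ (n - hammingNorm x)) := by
  have hbit : ∀ b : ZMod 2, bernoulliBit q b =
      if b ≠ 0 then ENNReal.ofReal q else ENNReal.ofReal (1 - q) := by
    intro b
    obtain rfl | rfl : b = 0 ∨ b = 1 := by revert b; decide
    · simp [bernoulliBit_zero]
    · simp [bernoulliBit_one]
  have hcard : (Finset.univ.filter fun i => ¬ x i ≠ 0).card = n - hammingNorm x := by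
    have := Finset.card_filter_add_card_filter_not (s := (Finset.univ : Finset (Fin n)))
      (fun i => x i ≠ 0)
    rw [Finset.card_univ, Fintype.card_fin] at this
    unfold hammingNorm
    omega
  rw [bernoulliVec_apply]
  simp only [hbit]
  rw [Finset.prod_ite, Finset.prod_const, Finset.prod_const, hcard,
    ENNReal.ofReal_mul (pow_nonneg q.2.1 _), ENNReal.ofReal_pow q.2.1,
    ENNReal.ofReal_pow (sub_nonneg.2 q.2.2)]
  rfl

theorem hammingNorm_le {n : ℕ} (x : Bits n) : hammingNorm x ≤ n := by
  simpa using hammingNorm_le_card_fintype (x := x)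

theorem sum_bernoulliVec_le_one (q : I) (n : ℕ) (s : Finset (Bits n)) :
    ∑ x ∈ s, bernoulliVec q n x ≤ 1 := by
  rw [← (bernoulliVec q n).tsum_coe]
  exact ENNReal.sum_le_tsum s

theorem pow_mul_pow_eq_exp {q : ℝ} (h0 : 0 < q) (h1 : q < 1) {w n : ℕ} (hw : w ≤ n) :
    q ^ w * (1 - q) ^ (n - w) = Real.exp (w * Real.log q + (n - w) * Real.log (1 - q)) := by
  rw [Real.exp_add, ← Nat.cast_sub hw, Real.exp_nat_mul, Real.exp_nat_mul, Real.exp_log h0,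
    Real.exp_log (sub_pos.2 h1)]

/-- A Hamming ball of radius `q n ≤ n / 2` has at most `2 ^ (n h_b(q))` elements. -/
theorem card_ball_le {q : ℝ} (h0 : 0 ≤ q) (h1 : q ≤ 1 / 2) (n : ℕ) (s : Finset (Bits n))
    (hs : ∀ x ∈ s, (hammingNorm x : ℝ) ≤ q * n) :
    (s.card : ℝ≥0∞) ≤ two_pow ((n * hb q : ℝ) : EReal) := by
  rcases h0.eq_or_lt with rfl | h0
  · have : s.card ≤ 1 := by
      rw [Finset.card_le_one_iff_subset_singleton]
      refine ⟨0, fun x hx => ?_⟩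
      have := hs x hx
      rw [zero_mul] at this
      have : hammingNorm x = 0 := by exact_mod_cast le_antisymm this (Nat.cast_nonneg _)
      simpa using this
    rw [two_pow_coe]
    simpa [hb] using this
  have hlt : q < 1 := by linarith
  set v : ℝ := Real.exp (-(n * Real.binEntropy q)) with hv
  -- For q ≤ 1/2 the Bernoulli(q) mass decreases with the weight, so each point of the ball has mass
  -- at least 2^(-n h_b(q)), its value at weight qn. The total mass 1 then bounds the number of
  -- points.
  have hle : ∀ x ∈ s, ENNReal.ofReal v ≤ bernoulliVec ⟨q, h0.le, hlt.le⟩ n x := by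
    intro x hx
    rw [bernoulliVec_eq_ofReal, pow_mul_pow_eq_exp h0 hlt (hammingNorm_le x)]
    refine ENNReal.ofReal_le_ofReal (Real.exp_le_exp.2 ?_)
    have hlog : Real.log q ≤ Real.log (1 - q) := Real.log_le_log h0 (by linarith)
    have := mul_nonneg (sub_nonneg.2 (hs x hx)) (sub_nonneg.2 hlog)
    rw [Real.binEntropy, Real.log_inv, Real.log_inv]
    linarith
  have hsum : (s.card : ℝ≥0∞) * ENNReal.ofReal v ≤ 1 := by
    rw [← nsmul_eq_mul]
    exact (Finset.card_nsmul_le_sum _ _ _ hle).trans (sum_bernoulliVec_le_one _ _ _)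
  have htwo : two_pow ((n * hb q : ℝ) : EReal) = (ENNReal.ofReal v)⁻¹ := by
    have hl := (Real.log_pos one_lt_two).ne'
    rw [two_pow_coe, hb, ← ENNReal.ofReal_inv_of_pos (Real.exp_pos _), ← Real.exp_neg, neg_neg]
    congr 2
    field_simp
  rw [htwo]
  exact ENNReal.le_inv_iff_mul_le.2 hsum

theorem two_pow_neg_nat_mul_coe (n : ℕ) (D : ℝ) :
    two_pow (-((n : EReal) * (D : EReal))) = ENNReal.ofReal (Real.exp (-(n * (D * Real.log 2)))) := by
  have : (-((n : EReal) * (D : EReal))) = ((-(n * D) : ℝ) : EReal) := by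
    rw [EReal.coe_neg, EReal.coe_mul, EReal.coe_natCast]
  rw [this, two_pow_coe]
  congr 2
  ring

/-- Change of measure from Bernoulli(`p`) to Bernoulli(`q`) on vectors of weight at least `q n`. -/
theorem pow_mul_pow_le_kl {p q : ℝ} (hp0 : 0 ≤ p) (hp1 : p < 1) (hq0 : 0 ≤ q) (hq1 : q < 1)
    {w n : ℕ} (hwn : w ≤ n) (hqw : q * n ≤ w) (hpq : p ≤ q ∨ (w : ℝ) = q * n) :
    ENNReal.ofReal (p ^ w * (1 - p) ^ (n - w)) ≤
      ENNReal.ofReal (q ^ w * (1 - q) ^ (n - w)) * two_pow (-((n : EReal) * klBits q p)) := by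
  rcases Nat.eq_zero_or_pos n with rfl | hn
  · obtain rfl : w = 0 := by omega
    simp [two_pow]
  have hn' : (0 : ℝ) < n := by exact_mod_cast hn
  -- Here the divergence is infinite; the left side vanishes too, because w ≥ qn > 0.
  by_cases hp : p = 0 ∧ q ≠ 0
  · have : w ≠ 0 := by
      rintro rfl
      have : 0 < q * n := mul_pos (lt_of_le_of_ne hq0 hp.2.symm) hn'
      simp at hqw
      linarith
    simp [hp.1, this]
  have hkl : klBits q p =
      ((q * Real.logb 2 (q / p) + (1 - q) * Real.logb 2 ((1 - q) / (1 - p)) : ℝ) : EReal) := by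
    rw [klBits, if_neg]
    rintro (h | h)
    · exact hp h
    · exact hp1.ne h.1
  have hl := (Real.log_pos one_lt_two).ne'
  have hD : (q * Real.logb 2 (q / p) + (1 - q) * Real.logb 2 ((1 - q) / (1 - p))) * Real.log 2 =
      q * Real.log (q / p) + (1 - q) * Real.log ((1 - q) / (1 - p)) := by
    rw [Real.logb, Real.logb]
    field_simp
  rw [hkl, two_pow_neg_nat_mul_coe, hD, Real.log_div (sub_pos.2 hq1).ne' (sub_pos.2 hp1).ne',
    ← ENNReal.ofReal_mul (mul_nonneg (pow_nonneg hq0 _) (pow_nonneg (sub_pos.2 hq1).le _))]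
  refine ENNReal.ofReal_le_ofReal ?_
  rcases hq0.eq_or_lt with rfl | hq0
  · have hw : p = 0 ∨ w = 0 := by
      rcases hpq with h | h
      · exact Or.inl (le_antisymm h hp0)
      · right; simpa using h
    rcases hw with rfl | rfl
    · simp
    · simp only [pow_zero, one_mul, sub_zero, one_pow, zero_mul, zero_add, Real.log_one, zero_sub,
        Nat.sub_zero, mul_neg, neg_neg, Real.exp_nat_mul]
      rw [Real.exp_log (sub_pos.2 hp1)]
  have hp0' : 0 < p := by
    refine lt_of_le_of_ne hp0 fun h => hp ⟨h.symm, hq0.ne'⟩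
  rw [pow_mul_pow_eq_exp hp0' hp1 hwn, pow_mul_pow_eq_exp hq0 hq1 hwn, ← Real.exp_add,
    Real.log_div hq0.ne' hp0'.ne']
  refine Real.exp_le_exp.2 ?_
  -- This product is exactly the difference of the two exponents.
  have key : 0 ≤ (w - q * n) * ((Real.log q - Real.log p) + (Real.log (1 - p) - Real.log (1 - q))) := by
    rcases hpq with h | h
    · refine mul_nonneg (sub_nonneg.2 hqw) (add_nonneg ?_ ?_)
      · exact sub_nonneg.2 (Real.log_le_log hp0' h)
      · exact sub_nonneg.2 (Real.log_le_log (by linarith) (by linarith))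
    · rw [h, sub_self, zero_mul]
  linarith

/-- After the change of measure the Bernoulli(q) mass is at most 1. The alternative p ≤ q serves
tails; the other serves a single weight class, where q may lie below p. -/
theorem sum_bernoulliVec_le_kl (p : I) (hp1 : (p : ℝ) < 1) {q : ℝ} (hq0 : 0 ≤ q) (hq1 : q < 1)
    (n : ℕ) (s : Finset (Bits n)) (hqw : ∀ x ∈ s, q * n ≤ hammingNorm x)
    (hpq : (p : ℝ) ≤ q ∨ ∀ x ∈ s, (hammingNorm x : ℝ) = q * n) :
    ∑ x ∈ s, bernoulliVec p n x ≤ two_pow (-((n : EReal) * klBits q p)) := by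
  calc ∑ x ∈ s, bernoulliVec p n x
      ≤ ∑ x ∈ s, bernoulliVec ⟨q, hq0, hq1.le⟩ n x * two_pow (-((n : EReal) * klBits q p)) := by
        refine Finset.sum_le_sum fun x hx => ?_
        rw [bernoulliVec_eq_ofReal, bernoulliVec_eq_ofReal]
        exact pow_mul_pow_le_kl p.2.1 hp1 hq0 hq1 (hammingNorm_le x) (hqw x hx)
          (hpq.imp_right fun h => h x hx)
    _ ≤ two_pow (-((n : EReal) * klBits q p)) := by
        rw [← Finset.sum_mul]
        exact mul_le_of_le_one_left zero_le (sum_bernoulliVec_le_one _ _ _)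

theorem map_bool_apply {β : Type*} [Fintype β] (μ : PMF β) (f : β → Bool) (b : Bool) :
    μ.map f b = ∑ x with f x = b, μ x := by
  rw [PMF.map_apply, tsum_fintype, Finset.sum_filter]
  refine Finset.sum_congr rfl fun x _ => ?_
  by_cases h : f x = b
  · rw [if_pos h.symm, if_pos h]
  · rw [if_neg fun h' => h h'.symm, if_neg h]

namespace LinCode

variable {n k m : ℕ} (c : LinCode n k m) {dec : Bits m → Bits n}

/-- Chernoff bound on the false rejection rate. -/
theorem sketchKeyless_PFR_le (hdec : c.IsDecoder dec) (p₁ α : I) {τ : ℝ}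
    (hpτ : (bscComp p₁ α : ℝ) < τ) (hτ : τ < 1) :
    (c.sketchKeyless dec τ).PFR p₁ α ≤ two_pow (-((n : EReal) * klBits τ (bscComp p₁ α))) := by
  classical
  rw [sketchKeyless_PFR, map_bool_apply]
  refine sum_bernoulliVec_le_kl _ (hpτ.trans hτ) ((bscComp p₁ α).2.1.trans hpτ.le) hτ n _
    (fun x hx => ?_) (Or.inl hpτ.le)
  simp only [threshold, Finset.mem_filter, Finset.mem_univ, true_and, decide_eq_false_iff_not,
    not_le] at hx
  -- The noise competes in its own coset, so the estimate is no heavier, whether or not decoding is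
  -- correct.
  have : (hammingNorm (dec (c.H.mulVec x)) : ℝ) ≤ hammingNorm x := by
    exact_mod_cast (hdec _).2 x rfl
  linarith

/-- The decoder is a section of H, hence injective: accepted syndromes embed in the ball of radius
τn, and each has probability 2⁻ᵐ. -/
theorem sketchKeyless_PFA_le (hdec : c.IsDecoder dec) (p₁ α : I) {τ : ℝ} (h0 : 0 ≤ τ)
    (hτ : τ ≤ 1 / 2) : (c.sketchKeyless dec τ).PFA p₁ α ≤
      two_pow ((-(n * ((m : ℝ) / n - hb τ)) : ℝ) : EReal) := by
  classical
  rw [sketchKeyless_PFA, blindDecision, map_bool_apply]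
  simp only [fairVec_apply, Finset.sum_const, nsmul_eq_mul]
  have hinj : Function.Injective dec := fun a b h => by rw [← (hdec a).1, h, (hdec b).1]
  have hm : (n : ℝ) * (m / n) = m := by
    rcases Nat.eq_zero_or_pos n with hn | hn
    · have := c.dim
      obtain rfl : m = 0 := by omega
      simp
    · field_simp
  have hcard := card_ball_le h0 hτ n
    ((Finset.univ.filter fun q => threshold τ (dec q) = true).map ⟨dec, hinj⟩) (by
      intro x hx
      simp only [Finset.mem_map, Finset.mem_filter, Finset.mem_univ, true_and, threshold,
        decide_eq_true_eq] at hx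
      obtain ⟨q, hq, rfl⟩ := hx
      exact hq)
  rw [Finset.card_map] at hcard
  have hsplit : ((-(n * ((m : ℝ) / n - hb τ)) : ℝ) : EReal) =
      ((n * hb τ : ℝ) : EReal) + ((-m : ℝ) : EReal) := by
    rw [← EReal.coe_add, mul_sub, hm]
    congr 1
    ring
  rw [hsplit, two_pow_add_coe, inv_two_pow_eq]
  gcongr

/-! ### Random systematic codes -/

section Systematic

variable {n k m : ℕ} (e : Fin n ≃ Fin m ⊕ Fin k) (P : Matrix (Fin m) (Fin k) (ZMod 2))

/-- The code with parity check matrix `[1 | P]`, with coordinates arranged by `e`. -/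
def systematic (h : k + m = n) : LinCode n k m where
  G := (Matrix.fromCols P.transpose 1).submatrix id e
  H := (Matrix.fromCols 1 P).submatrix id e
  dim := h
  G_rank := by
    rw [← Matrix.vecMul_injective_iff]
    intro v w hvw
    have := Matrix.submatrix_vecMul_equiv (Matrix.fromCols P.transpose 1) v (Equiv.refl _) e
    have h2 := Matrix.submatrix_vecMul_equiv (Matrix.fromCols P.transpose 1) w (Equiv.refl _) e
    simp only [Equiv.coe_refl] at this h2
    simp only [this, h2, Matrix.vecMul_fromCols, Matrix.vecMul_one] at hvw
    funext i
    have := congrFun hvw (e.symm (Sum.inr i))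
    simpa using this
  H_rank := by
    rw [← Matrix.vecMul_injective_iff]
    intro v w hvw
    have := Matrix.submatrix_vecMul_equiv (Matrix.fromCols 1 P) v (Equiv.refl _) e
    have h2 := Matrix.submatrix_vecMul_equiv (Matrix.fromCols 1 P) w (Equiv.refl _) e
    simp only [Equiv.coe_refl] at this h2
    simp only [this, h2, Matrix.vecMul_fromCols, Matrix.vecMul_one] at hvw
    funext i
    have := congrFun hvw (e.symm (Sum.inl i))
    simpa using this
  ortho := by
    rw [Matrix.transpose_submatrix, Matrix.submatrix_mul_equiv, Matrix.transpose_fromCols,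
      Matrix.fromCols_mul_fromRows]
    simp [ZModModule.add_self]

theorem systematic_H_mulVec (h : k + m = n) (x : Bits n) :
    (systematic e P h).H.mulVec x =
      (fun i => x (e.symm (Sum.inl i))) + P.mulVec fun j => x (e.symm (Sum.inr j)) := by
  have := Matrix.submatrix_mulVec_equiv (Matrix.fromCols 1 P) x id e
  rw [Matrix.fromCols_mulVec, Matrix.one_mulVec] at this
  exact this

/-- Among the systematic codes, a fraction of at most `2⁻ᵐ` contains a given nonzero vector. -/
theorem card_systematic_mul_le (h : k + m = n) {v : Bits n} (hv : v ≠ 0) :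
    (Finset.univ.filter fun P => (systematic e P h).H.mulVec v = 0).card * 2 ^ m ≤
      Fintype.card (Matrix (Fin m) (Fin k) (ZMod 2)) := by
  classical
  simp only [systematic_H_mulVec]
  set a : Bits m := fun i => v (e.symm (Sum.inl i)) with ha
  set b : Bits k := fun j => v (e.symm (Sum.inr j)) with hb
  -- If b = 0, the syndrome is a ≠ 0 for every P, and no code contains v.
  by_cases hb0 : b = 0
  · have ha0 : a ≠ 0 := by
      intro ha0
      refine hv (funext fun i => ?_)
      obtain ⟨s, rfl⟩ := e.symm.surjective i
      rcases s with s | s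
      · exact congrFun ha0 s
      · exact congrFun hb0 s
    simp [hb0, ha0]
  obtain ⟨j, hj⟩ := Function.ne_iff.1 hb0
  have hj1 : b j = 1 := by
    have : ∀ y : ZMod 2, y ≠ 0 → y = 1 := by decide
    exact this _ hj
  have hcard : Fintype.card (Bits m) = 2 ^ m := by simp
  rw [← hcard, ← Finset.card_univ (α := Bits m), ← Finset.card_product,
    ← Finset.card_univ (α := Matrix (Fin m) (Fin k) (ZMod 2))]
  -- Adding t to column j, where b is 1, shifts the syndrome by t. The 2ᵐ translates of the set of
  -- solutions are thus disjoint.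
  have hmul : ∀ (Q : Matrix (Fin m) (Fin k) (ZMod 2)) (t : Bits m),
      (Q + Matrix.vecMulVec t (Pi.single j 1)).mulVec b = Q.mulVec b + t := by
    intro Q t
    rw [Matrix.add_mulVec, Matrix.vecMulVec_mulVec]
    simp [hj1]
  refine Finset.card_le_card_of_injOn
    (fun Qt => Qt.1 + Matrix.vecMulVec Qt.2 (Pi.single j 1)) (fun _ _ => Finset.mem_coe.2
      (Finset.mem_univ _)) ?_
  rintro ⟨Q, t⟩ hQ ⟨Q', t'⟩ hQ' heq
  simp only [Finset.coe_product, Set.mem_prod, Finset.mem_coe, Finset.mem_filter, Finset.mem_univ,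
    true_and, and_true] at hQ hQ' heq
  have h1 := hmul Q t
  rw [heq, hmul Q' t'] at h1
  have h2 : Q.mulVec b = Q'.mulVec b := add_left_cancel (hQ.trans hQ'.symm)
  rw [h2] at h1
  have ht : t' = t := add_left_cancel h1
  subst ht
  rw [add_left_injective _ heq]

end Systematic

/-! ### Random coding union bound -/

variable {n k m : ℕ} (c : LinCode n k m)

/-- The noise vectors on which a decoder can fail. -/
def Ambiguous (N : Bits n) : Prop :=
  ∃ W, W ≠ N ∧ c.H.mulVec (W - N) = 0 ∧ hammingNorm W ≤ hammingNorm N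

-- A wrong estimate witnesses the ambiguity of N. The right side does not mention the decoder, so
-- one code serves every rule for ties.
open Classical in
theorem errorProb_le {dec : Bits m → Bits n} (hdec : c.IsDecoder dec) (p : I) :
    c.errorProb dec p ≤ ∑ N with c.Ambiguous N, bernoulliVec p n N := by
  have hmap : ∀ Z : Bits k, ((bernoulliVec p n).map fun N =>
      let X := c.G.transpose.mulVec Z
      let Y := X + N
      decide (Y + dec (c.H.mulVec Y) ≠ X)) =
      (bernoulliVec p n).map fun N => decide (dec (c.H.mulVec N) ≠ N) := by
    intro Z
    congr 1
    funext N
    simp only [Matrix.mulVec_add, c.H_G_mulVec, zero_add, add_assoc, decide_eq_decide]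
    rw [Ne, add_eq_left, ← ZModModule.sub_eq_add, sub_eq_zero, eq_comm]
  rw [errorProb]
  simp only [hmap, PMF.bind_const]
  rw [map_bool_apply]
  refine Finset.sum_le_sum_of_subset fun N hN => ?_
  simp only [Finset.mem_filter, Finset.mem_univ, true_and, decide_eq_true_eq] at hN ⊢
  refine ⟨_, hN, ?_, (hdec _).2 N rfl⟩
  rw [Matrix.mulVec_sub, (hdec _).1, sub_self]

theorem exists_isDecoder : ∃ dec, c.IsDecoder dec := by
  classical
  have : ∀ s, ∃ W, c.H.mulVec W = s ∧ ∀ W', c.H.mulVec W' = s → hammingNorm W ≤ hammingNorm W' := by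
    intro s
    obtain ⟨W₀, hW₀⟩ := c.H_surjective s
    obtain ⟨W, hW, hmin⟩ := Finset.exists_min_image
      (Finset.univ.filter fun W => c.H.mulVec W = s) hammingNorm ⟨W₀, by simpa using hW₀⟩
    exact ⟨W, by simpa using hW, fun W' hW' => hmin W' (by simpa using hW')⟩
  choose dec h using this
  exact ⟨dec, h⟩

open Classical in
/-- Union bound: the fraction of systematic codes that are ambiguous at `N`. -/
theorem card_ambiguous_le (e : Fin n ≃ Fin m ⊕ Fin k) (h : k + m = n) (N : Bits n) :
    ((Finset.univ.filter fun P => (systematic e P h).Ambiguous N).card : ℝ≥0∞) ≤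
      Fintype.card (Matrix (Fin m) (Fin k) (ZMod 2)) *
        min 1 ((Finset.univ.filter fun W : Bits n => hammingNorm W ≤ hammingNorm N).card *
          ((2 : ℝ≥0∞)⁻¹) ^ m) := by
  set M := Fintype.card (Matrix (Fin m) (Fin k) (ZMod 2)) with hM
  set B := Finset.univ.filter fun W : Bits n => hammingNorm W ≤ hammingNorm N with hB
  rcases min_choice (1 : ℝ≥0∞) (B.card * ((2 : ℝ≥0∞)⁻¹) ^ m) with h1 | h1
  · rw [h1, mul_one]
    exact_mod_cast Finset.card_le_univ _
  rw [h1]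
  have hsub : (Finset.univ.filter fun P => (systematic e P h).Ambiguous N) ⊆
      (B.erase N).biUnion fun W =>
        Finset.univ.filter fun P => (systematic e P h).H.mulVec (W - N) = 0 := by
    intro P hP
    simp only [Finset.mem_filter, Finset.mem_univ, true_and] at hP
    obtain ⟨W, hW, hH, hle⟩ := hP
    simp only [Finset.mem_biUnion, Finset.mem_erase, Finset.mem_filter, Finset.mem_univ, true_and,
      hB]
    exact ⟨W, ⟨hW, hle⟩, hH⟩
  have hW : ∀ W ∈ B.erase N,
      ((Finset.univ.filter fun P => (systematic e P h).H.mulVec (W - N) = 0).card : ℝ≥0∞) ≤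
        M * ((2 : ℝ≥0∞)⁻¹) ^ m := by
    intro W hW
    have := card_systematic_mul_le e h (sub_ne_zero.2 (Finset.mem_erase.1 hW).1)
    rw [← ENNReal.inv_pow, ← div_eq_mul_inv, ENNReal.le_div_iff_mul_le (by simp) (by simp)]
    exact_mod_cast this
  calc ((Finset.univ.filter fun P => (systematic e P h).Ambiguous N).card : ℝ≥0∞)
      ≤ ∑ W ∈ B.erase N,
        ((Finset.univ.filter fun P => (systematic e P h).H.mulVec (W - N) = 0).card : ℝ≥0∞) := by
        exact_mod_cast (Finset.card_le_card hsub).trans Finset.card_biUnion_le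
    _ ≤ ∑ W ∈ B.erase N, M * ((2 : ℝ≥0∞)⁻¹) ^ m := Finset.sum_le_sum hW
    _ ≤ M * (B.card * ((2 : ℝ≥0∞)⁻¹) ^ m) := by
        rw [Finset.sum_const, nsmul_eq_mul, mul_left_comm]
        gcongr
        exact Finset.erase_subset _ _

open Classical in
/-- The random coding union bound. -/
theorem exists_sum_ambiguous_le (h : k + m = n) (p : I) : ∃ c : LinCode n k m,
    ∑ N with c.Ambiguous N, bernoulliVec p n N ≤
      ∑ N : Bits n, bernoulliVec p n N *
        min 1 ((Finset.univ.filter fun W : Bits n => hammingNorm W ≤ hammingNorm N).card *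
          ((2 : ℝ≥0∞)⁻¹) ^ m) := by
  have e : Fin n ≃ Fin m ⊕ Fin k := (finCongr (by omega)).trans finSumFinEquiv.symm
  set f : Matrix (Fin m) (Fin k) (ZMod 2) → ℝ≥0∞ := fun P =>
    ∑ N with (systematic e P h).Ambiguous N, bernoulliVec p n N with hf
  -- The best P does at least as well as the average over all P.
  obtain ⟨P, hP⟩ := Finite.exists_min f
  refine ⟨systematic e P h, ?_⟩
  change f P ≤ _
  set M := Fintype.card (Matrix (Fin m) (Fin k) (ZMod 2)) with hM
  have hM0 : (M : ℝ≥0∞) ≠ 0 := by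
    rw [Nat.cast_ne_zero]
    exact Fintype.card_ne_zero
  rw [← ENNReal.mul_le_mul_iff_right hM0 (ENNReal.natCast_ne_top M)]
  calc (M : ℝ≥0∞) * f P ≤ ∑ Q, f Q := by
        rw [← nsmul_eq_mul, hM, ← Finset.card_univ]
        exact Finset.card_nsmul_le_sum _ _ _ fun Q _ => hP Q
    _ = ∑ N : Bits n, bernoulliVec p n N *
        (Finset.univ.filter fun Q => (systematic e Q h).Ambiguous N).card := by
        simp only [hf, Finset.sum_filter]
        rw [Finset.sum_comm]
        refine Finset.sum_congr rfl fun N _ => ?_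
        rw [← Finset.sum_filter, Finset.sum_const, nsmul_eq_mul, mul_comm]
    _ ≤ _ := by
        rw [Finset.mul_sum]
        refine Finset.sum_le_sum fun N _ => ?_
        rw [mul_left_comm]
        gcongr
        exact card_ambiguous_le e h N

end LinCode

/-! ### From the union bound to the exponent E(R) -/

theorem neg_mul_add_le_neg_mul_errorExponent {n : ℕ} (hn : 0 < n) (p R : ℝ) {q : ℝ} (hq0 : 0 ≤ q)
    (hq1 : q ≤ 1) : -((n : EReal) * klBits q p) + ((-(n * max (1 - hb q - R) 0) : ℝ) : EReal) ≤
      -((n : EReal) * errorExponent p R) := by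
  have hE : errorExponent p R ≤ klBits q p + ((max (1 - hb q - R) 0 : ℝ) : EReal) :=
    iInf₂_le q ⟨hq0, hq1⟩
  have hnn : (0 : EReal) ≤ n := by exact_mod_cast n.zero_le
  refine le_trans (le_of_eq ?_) (EReal.neg_le_neg_iff.2 (mul_le_mul_of_nonneg_left hE hnn))
  have hn' : (0 : ℝ) < n := by exact_mod_cast hn
  rw [← EReal.coe_natCast]
  unfold klBits
  split_ifs with h
  · rw [EReal.coe_mul_top_of_pos hn', EReal.top_add_coe, EReal.coe_mul_top_of_pos hn', EReal.neg_top,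
      EReal.bot_add]
  · norm_cast
    ring

/-- The contribution of one weight class: as m = n(1 - R), the capped union bound is 2^(-n max{1 -
h_b(q) - R, 0}). -/
theorem two_pow_kl_mul_min_le {n k m : ℕ} (hn : 0 < n) (h : k + m = n) (p : ℝ) {q : ℝ}
    (hq0 : 0 ≤ q) (hq1 : q ≤ 1) :
    two_pow (-((n : EReal) * klBits q p)) *
        min 1 (two_pow ((n * hb q : ℝ) : EReal) * ((2 : ℝ≥0∞)⁻¹) ^ m) ≤
      two_pow (-((n : EReal) * errorExponent p ((k : ℝ) / n))) := by
  have hn' : (n : ℝ) ≠ 0 := by exact_mod_cast hn.ne'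
  have hR : (n : ℝ) * (k / n) = k := by field_simp
  have hkm : (k : ℝ) + m = n := by exact_mod_cast h
  have hmin : min 1 (two_pow ((n * hb q : ℝ) : EReal) * ((2 : ℝ≥0∞)⁻¹) ^ m) ≤
      two_pow ((-(n * max (1 - hb q - k / n) 0) : ℝ) : EReal) := by
    rcases max_choice (1 - hb q - (k : ℝ) / n) 0 with hx | hx
    · refine (min_le_right _ _).trans (le_of_eq ?_)
      rw [inv_two_pow_eq, ← two_pow_add_coe, ← EReal.coe_add, hx]
      congr 2
      linear_combination -hkm - hR
    · refine (min_le_left _ _).trans (le_of_eq ?_)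
      rw [hx, two_pow_coe]
      simp
  calc _ ≤ two_pow (-((n : EReal) * klBits q p)) *
        two_pow ((-(n * max (1 - hb q - k / n) 0) : ℝ) : EReal) := by gcongr
    _ ≤ _ := by
      rw [← two_pow_add_coe]
      exact two_pow_mono (neg_mul_add_le_neg_mul_errorExponent hn p _ hq0 hq1)

open Classical in
theorem sum_bernoulliVec_mul_min_le {n k m : ℕ} (hn : 0 < n) (h : k + m = n) (p : I)
    (hp : (p : ℝ) < 1 / 2) :
    ∑ N : Bits n, bernoulliVec p n N *
        min 1 ((Finset.univ.filter fun W : Bits n => hammingNorm W ≤ hammingNorm N).card *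
          ((2 : ℝ≥0∞)⁻¹) ^ m) ≤
      (n + 2) * two_pow (-((n : EReal) * errorExponent p ((k : ℝ) / n))) := by
  have hn' : (0 : ℝ) < n := by exact_mod_cast hn
  have hp1 : (p : ℝ) < 1 := by linarith
  set T := two_pow (-((n : EReal) * errorExponent p ((k : ℝ) / n))) with hT
  set g : Bits n → ℝ≥0∞ := fun N => bernoulliVec p n N *
    min 1 ((Finset.univ.filter fun W : Bits n => hammingNorm W ≤ hammingNorm N).card *
      ((2 : ℝ≥0∞)⁻¹) ^ m) with hg
  -- Weights of at least n/2 are lumped together at q = 1/2, where h_b = 1 kills the second part of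
  -- the exponent, so the cap 1 suffices.
  have hheavy : ∑ N with ¬ 2 * hammingNorm N < n, g N ≤ T := by
    have h1 : ∑ N with ¬ 2 * hammingNorm N < n, g N ≤
        ∑ N : Bits n with ¬ 2 * hammingNorm N < n, bernoulliVec p n N :=
      Finset.sum_le_sum fun N _ => mul_le_of_le_one_right zero_le (min_le_left _ _)
    have h2 := sum_bernoulliVec_le_kl p hp1 (q := 1 / 2) (by norm_num) (by norm_num) n
      (Finset.univ.filter fun N : Bits n => ¬ 2 * hammingNorm N < n) (by
        intro N hN
        simp only [Finset.mem_filter, Finset.mem_univ, true_and, not_lt] at hN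
        have : (n : ℝ) ≤ 2 * hammingNorm N := by exact_mod_cast hN
        linarith) (Or.inl hp.le)
    have h3 := neg_mul_add_le_neg_mul_errorExponent hn p ((k : ℝ) / n) (q := 1 / 2)
      (by norm_num) (by norm_num)
    have hmax : max (1 - hb (1 / 2) - (k : ℝ) / n) 0 = 0 := by
      have : hb (1 / 2) = 1 := by
        rw [hb, one_div, Real.binEntropy_two_inv, div_self (Real.log_pos one_lt_two).ne']
      rw [this]
      apply max_eq_right
      have : 0 ≤ (k : ℝ) / n := by positivity
      linarith
    rw [hmax, mul_zero, neg_zero, EReal.coe_zero, add_zero] at h3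
    exact h1.trans (h2.trans (two_pow_mono h3))
  -- Below n/2 the exponent is taken at q = w/n, where the ball estimate applies. The range
  -- overcounts: classes with 2w ≥ n are empty here. Its n + 1 terms and the heavy one give n + 2.
  have hlight : ∀ w ∈ Finset.range (n + 1),
      ∑ N ∈ (Finset.univ.filter fun N : Bits n => 2 * hammingNorm N < n) with hammingNorm N = w,
        g N ≤ T := by
    intro w _
    by_cases hw : 2 * w < n
    · have hw' : 2 * (w : ℝ) < n := by exact_mod_cast hw
      have hqn : (w : ℝ) / n * n = w := by field_simp
      have hq0 : (0 : ℝ) ≤ w / n := by positivity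
      have hq1 : (w : ℝ) / n ≤ 1 / 2 := by
        rw [div_le_iff₀ hn']; linarith
      have hball := card_ball_le hq0 hq1 n
        (Finset.univ.filter fun W : Bits n => hammingNorm W ≤ w) (by
          intro x hx
          rw [hqn]
          simpa using hx)
      refine le_trans ?_ (two_pow_kl_mul_min_le hn h p hq0 (by linarith))
      have hkl := sum_bernoulliVec_le_kl p hp1 hq0 (by linarith) n
        ((Finset.univ.filter fun N : Bits n => 2 * hammingNorm N < n).filter
          fun N => hammingNorm N = w)
        (by intro x hx; rw [hqn, (Finset.mem_filter.1 hx).2])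
        (Or.inr (by intro x hx; rw [hqn, (Finset.mem_filter.1 hx).2]))
      refine le_trans ?_ (mul_le_mul_left hkl _)
      rw [Finset.sum_mul]
      refine Finset.sum_le_sum fun N hN => ?_
      simp only [hg, (Finset.mem_filter.1 hN).2]
      gcongr
    · rw [Finset.sum_eq_zero]
      · exact zero_le
      · intro N hN
        simp only [Finset.mem_filter, Finset.mem_univ, true_and] at hN
        omega
  have hsplit := Finset.sum_filter_add_sum_filter_not (Finset.univ : Finset (Bits n))
    (fun N => 2 * hammingNorm N < n) g
  have hfiber := Finset.sum_fiberwise_of_maps_to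
    (s := Finset.univ.filter fun N : Bits n => 2 * hammingNorm N < n) (t := Finset.range (n + 1))
    (g := hammingNorm) (fun N _ => Finset.mem_range.2 (Nat.lt_succ_of_le (hammingNorm_le N))) g
  rw [← hsplit, ← hfiber]
  refine (add_le_add (Finset.sum_le_card_nsmul _ _ _ hlight) hheavy).trans (le_of_eq ?_)
  rw [Finset.card_range, nsmul_eq_mul]
  push_cast
  ring

theorem LinCode.exists_errorProb_le {n k m : ℕ} (h : k + m = n) (p : I) (hp : (p : ℝ) < 1 / 2) :
    ∃ c : LinCode n k m, ∀ dec, c.IsDecoder dec → c.errorProb dec p ≤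
      two_pow (-((n : EReal) * errorExponent p ((k : ℝ) / n)) +
        (Real.logb 2 (n + 2) : EReal)) := by
  classical
  have hlog : two_pow (Real.logb 2 (n + 2) : EReal) = n + 2 := by
    have : (0 : ℝ) < n + 2 := by positivity
    rw [two_pow_coe, Real.logb, div_mul_cancel₀ _ (Real.log_pos one_lt_two).ne', Real.exp_log this]
    exact_mod_cast ENNReal.ofReal_natCast (n + 2)
  obtain ⟨c, hc⟩ := exists_sum_ambiguous_le h p
  refine ⟨c, fun dec hdec => ?_⟩
  rw [two_pow_add_coe, hlog, mul_comm]
  -- At length 0 the bound equals 2 and is trivial.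
  rcases Nat.eq_zero_or_pos n with rfl | hn
  · refine (PMF.coe_le_one _ _).trans ?_
    simp [two_pow]
  · exact (c.errorProb_le hdec p).trans (hc.trans (sum_bernoulliVec_mul_min_le hn h p hp))

theorem logb_add_two_isLittleO :
    (fun n : ℕ => Real.logb 2 (n + 2)) =o[Filter.atTop] (fun n : ℕ => (n : ℝ)) := by
  have h1 : (fun n : ℕ => Real.logb 2 (n + 2)) =o[Filter.atTop] (fun n : ℕ => (n : ℝ) + 2) := by
    have ht : Filter.Tendsto (fun n : ℕ => (n : ℝ) + 2) Filter.atTop Filter.atTop :=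
      Filter.tendsto_atTop_add_const_right _ _ tendsto_natCast_atTop_atTop
    have := (Real.isLittleO_log_id_atTop.comp_tendsto ht).const_mul_left (Real.log 2)⁻¹
    refine this.congr (fun n => ?_) fun n => rfl
    simp [Real.logb, div_eq_inv_mul]
  refine h1.trans_isBigO (Asymptotics.IsBigO.of_bound 3 ?_)
  filter_upwards [Filter.eventually_ge_atTop 1] with n hn
  have : (1 : ℝ) ≤ n := by exact_mod_cast hn
  rw [Real.norm_of_nonneg (by positivity), Real.norm_of_nonneg (by positivity)]
  linarith

theorem bscComp_lt_half {p₁ α : I} (hp₁ : (p₁ : ℝ) < 1 / 2) (hα : (α : ℝ) < 1 / 2) :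
    (bscComp p₁ α : ℝ) < 1 / 2 := by
  simp only [bscComp]
  nlinarith [mul_pos (sub_pos.2 hp₁) (sub_pos.2 hα)]

end SecureBiometrics

/-! ### The main theorem -/

open SecureBiometrics SecureBiometrics.LinCode SecureBiometrics.Datum in
theorem theorem1 (p₁ α : unitInterval) (τ : ℝ) (hp₁ : (p₁ : ℝ) < 1 / 2) (hα : (α : ℝ) < 1 / 2)
    (hpτ : (bscComp p₁ α : ℝ) < τ) (hτ : τ < 1 / 2) :
    -- claims about every code and every decoder of that code
    (∀ (n k m : ℕ) (c : LinCode n k m) (dec : Bits m → Bits n), c.IsDecoder dec →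
      -- the FRR of the four systems is the same
      ((c.fuzzyKeyed dec τ).PFR p₁ α = (c.sketchKeyless dec τ).PFR p₁ α ∧
        (c.fuzzyKeyless dec τ).PFR p₁ α = (c.sketchKeyless dec τ).PFR p₁ α ∧
        (c.sketchKeyed dec τ).PFR p₁ α = (c.sketchKeyless dec τ).PFR p₁ α) ∧
      -- the FAR of the four systems is the same
      ((c.fuzzyKeyed dec τ).PFA p₁ α = (c.sketchKeyless dec τ).PFA p₁ α ∧
        (c.fuzzyKeyless dec τ).PFA p₁ α = (c.sketchKeyless dec τ).PFA p₁ α ∧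
        (c.sketchKeyed dec τ).PFA p₁ α = (c.sketchKeyless dec τ).PFA p₁ α) ∧
      -- (ii)
      (c.sketchKeyless dec τ).PFA p₁ α ≤ two_pow ((-(n * ((m : ℝ) / n - hb τ)) : ℝ) : EReal) ∧
      -- (iii) and (iv)
      ((c.fuzzyKeyed dec τ).PSA p₁ α {key} = (c.fuzzyKeyed dec τ).PFA p₁ α ∧
        (c.sketchKeyed dec τ).PSA p₁ α {key} = (c.sketchKeyed dec τ).PFA p₁ α ∧
        (c.fuzzyKeyed dec τ).PSA p₁ α {bio} = (c.fuzzyKeyed dec τ).PFA p₁ α ∧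
        (c.sketchKeyed dec τ).PSA p₁ α {bio} = (c.sketchKeyed dec τ).PFA p₁ α) ∧
      -- (v)
      (∀ V ∈ ({{stored}, {bio, key}, {bio, stored}, {stored, key}, {bio, stored, key}} :
          Set (Set Datum)),
        (c.fuzzyKeyed dec τ).PSA p₁ α V = 1 ∧ (c.sketchKeyed dec τ).PSA p₁ α V = 1) ∧
      -- (vi)
      (∀ V ∈ ({{stored}, {bio}, {bio, stored}} : Set (Set Datum)),
        (c.fuzzyKeyless dec τ).PSA p₁ α V = 1 ∧ (c.sketchKeyless dec τ).PSA p₁ α V = 1)) ∧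
    -- (i) for every sequence of codes of growing length whose decoding error probability on the
    -- BSC(`p`) is at most `2 ^ (-n E(R) + o(n))`; by the above it concerns all four systems
    (∀ (n k m : ℕ → ℕ) (c : ∀ j, LinCode (n j) (k j) (m j)) (dec : ∀ j, Bits (m j) → Bits (n j))
        (ε : ℕ → ℝ), Filter.Tendsto n Filter.atTop Filter.atTop →
      ε =o[Filter.atTop] (fun j => (n j : ℝ)) → (∀ j, (c j).IsDecoder (dec j)) →
      (∀ j, (c j).errorProb (dec j) (bscComp p₁ α) ≤
        two_pow (-((n j : EReal) * errorExponent (bscComp p₁ α) ((k j : ℝ) / n j)) + (ε j : EReal))) →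
      ∀ j, ((c j).sketchKeyless (dec j) τ).PFR p₁ α ≤
        two_pow (-((n j : EReal) * klBits τ (bscComp p₁ α))) +
        two_pow (-((n j : EReal) * errorExponent (bscComp p₁ α) ((k j : ℝ) / n j)) +
          (ε j : EReal))) ∧
    -- codes as in (i) exist for all lengths and dimensions, with a common `o(n)` term
    (∃ ε : ℕ → ℝ, ε =o[Filter.atTop] (fun n : ℕ => (n : ℝ)) ∧
      ∀ n k m : ℕ, k + m = n → ∃ c : LinCode n k m, (∃ dec, c.IsDecoder dec) ∧
        ∀ dec, c.IsDecoder dec →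
          c.errorProb dec (bscComp p₁ α) ≤
            two_pow (-((n : EReal) * errorExponent (bscComp p₁ α) ((k : ℝ) / n)) +
              (ε n : EReal))) := by
  have h0 : 0 ≤ τ := (bscComp p₁ α).2.1.trans hpτ.le
  refine ⟨fun n k m c dec hdec => ⟨?_, ?_, ?_, ?_, ?_, ?_⟩, ?_, ?_⟩
  · simp only [fuzzyKeyed_PFR, fuzzyKeyless_PFR, sketchKeyed_PFR, sketchKeyless_PFR, and_self]
  · simp only [fuzzyKeyed_PFA, fuzzyKeyless_PFA, sketchKeyed_PFA, sketchKeyless_PFA, and_self]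
  · exact c.sketchKeyless_PFA_le hdec p₁ α h0 hτ.le
  · simp only [fuzzyKeyed_PFA, sketchKeyed_PFA, fuzzyKeyed_PSA_key, sketchKeyed_PSA_key,
      fuzzyKeyed_PSA_bio, sketchKeyed_PSA_bio, and_self]
  · intro V hV
    by_cases hs : stored ∈ V
    · exact ⟨c.fuzzyKeyed_PSA_stored p₁ α hdec h0 V hs, c.sketchKeyed_PSA_stored p₁ α hdec h0 V hs⟩
    · have hbk : bio ∈ V ∧ key ∈ V := by
        simp only [Set.mem_insert_iff, Set.mem_singleton_iff] at hV
        rcases hV with rfl | rfl | rfl | rfl | rfl <;> simp_all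
      exact ⟨c.fuzzyKeyed_PSA_bio_key p₁ α hdec h0 V hbk.1 hbk.2,
        c.sketchKeyed_PSA_bio_key p₁ α hdec h0 V hbk.1 hbk.2⟩
  · intro V hV
    by_cases hs : stored ∈ V
    · exact ⟨c.fuzzyKeyless_PSA_stored p₁ α hdec h0 V hs,
        c.sketchKeyless_PSA_stored p₁ α hdec h0 V hs⟩
    · have hb : bio ∈ V := by
        simp only [Set.mem_insert_iff, Set.mem_singleton_iff] at hV
        rcases hV with rfl | rfl | rfl <;> simp_all
      exact ⟨c.fuzzyKeyless_PSA_bio p₁ α hdec h0 V hb, c.sketchKeyless_PSA_bio p₁ α hdec h0 V hb⟩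
  · intro n k m c dec ε _ _ hdec _ j
    -- A decoding error yields an estimate no heavier than the noise, so the Chernoff term covers it
    -- as well.
    exact ((c j).sketchKeyless_PFR_le (hdec j) p₁ α hpτ (by linarith)).trans le_self_add
  · refine ⟨_, logb_add_two_isLittleO, fun n k m h => ?_⟩
    obtain ⟨c, hc⟩ := exists_errorProb_le h (bscComp p₁ α) (bscComp_lt_half hp₁ hα)
    exact ⟨c, c.exists_isDecoder, hc⟩
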